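/- Let $p\ge 2$ be a real number, let $d$ be a natural number, and let $\mathcal B$ be the Banach space of real symmetric $d\times d$ matrices with the Schatten $p$-norm $$\|X\|_p=\bigl(\operatorname{Tr}|X|^p\bigr)^{1/p}=\Bigl(\sum_{i=1}^d|\lambda_i(X)|^p\Bigr)^{1/p},$$ where $\lambda_1(X),\dots,\lambda_d(X)$ are the eigenvalues of $X$ counted with multiplicity. For a function $f:\mathcal B\to\mathbb R$ write $\delta_H f(X)=\frac{d}{dt}\big|_{t=0}f(X+tH)$ and $\delta_{H,H}f=\delta_H(\delta_H f)$. A map $f$ from $\mathcal B$ to a normed space is called Gâteaux differentiable at $X$ if all its directional derivatives at $X$ exist and form a bounded linear map $D_Xf$; a function $f:\mathcal B\to\mathbb R$ is called twice Gâteaux differentiable at $X$ if it is Gâteaux differentiable at every point of a neighbourhood of $X$ and $Y\mapsto D_Yf\in\mathcal B^*$ is Gâteaux differentiable at $X$. Then the norm of $\mathcal B$ satisfies the smoothness Assumption A1 with constants $A_1=1$ and $A_2=3(p-1)$, that is: $\|\cdot\|_p$ is twice Gâteaux differentiable at every nonzero point of $\mathcal B$, and for all $X,H\in\mathcal B$ with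 $X\ne 0$, $$\bigl|\delta_H\|X\|_p\bigr|\le\|H\|_p,\qquad \bigl|\delta_{H,H}\|X\|_p\bigr|\le 3(p-1)\,\frac{\|H\|_p^2}{\|X\|_p}.$$ -/

import Mathlib

/-! ### Gateaux differentiability and the smoothness assumption on a Banach norm -/

section Gateaux

variable {E F : Type*} [NormedAddCommGroup E] [NormedSpace ℝ E]
  [NormedAddCommGroup F] [NormedSpace ℝ F]

/-- `f' : E →L[ℝ] F` is the Gateaux derivative of `f` at `x`: for every direction `v` the map
`t ↦ f (x + t v)` is differentiable at `0`, with derivative `f' v`. -/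
def HasGateauxDerivAt (f : E → F) (f' : E →L[ℝ] F) (x : E) : Prop :=
  ∀ v : E, HasLineDerivAt ℝ f (f' v) x v

/-- `f` is Gateaux differentiable at `x`: all directional derivatives exist and form a bounded
linear map. -/
def GateauxDifferentiableAt (f : E → F) (x : E) : Prop :=
  ∃ f' : E →L[ℝ] F, HasGateauxDerivAt f f' x

/-- `f` is twice Gateaux differentiable at `x`: it is Gateaux differentiable around `x`, and its
Gateaux derivative, as a map into the dual space, is Gateaux differentiable at `x`. -/
def TwiceGateauxDifferentiableAt (f : E → ℝ) (x : E) : Prop :=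
  ∃ f' : E → (E →L[ℝ] ℝ),
    (∀ᶠ y in nhds x, HasGateauxDerivAt f (f' y) y) ∧ GateauxDifferentiableAt f' x

/-- The Gateaux differential `δ_v f (x) = d/dt f (x + t v)` at `t = 0`. -/
noncomputable def gateauxDifferential (v : E) (f : E → ℝ) (x : E) : ℝ :=
  lineDeriv ℝ f x v

/-- The second Gateaux differential `δ_{u,v} f (x) = δ_u (δ_v f) (x)`. -/
noncomputable def secondGateauxDifferential (u v : E) (f : E → ℝ) (x : E) : ℝ :=
  gateauxDifferential u (gateauxDifferential v f) x

end Gateaux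

/-- The smoothness assumption A1 on the norm of the Banach space `B`, with constants `A₁`, `A₂`. -/
structure AssumptionA1 (B : Type*) [NormedAddCommGroup B] [NormedSpace ℝ B] [CompleteSpace B]
    (A₁ A₂ : ℝ) : Prop where
  one_le : 1 ≤ A₁
  pos : 0 < A₂
  differentiable : ∀ x : B, x ≠ 0 → TwiceGateauxDifferentiableAt (fun y : B => ‖y‖) x
  first_bound : ∀ x v : B, x ≠ 0 → |gateauxDifferential v (fun y : B => ‖y‖) x| ≤ A₁ * ‖v‖
  second_bound : ∀ x v : B, x ≠ 0 →
    |secondGateauxDifferential v v (fun y : B => ‖y‖) x| ≤ A₂ * (‖v‖ ^ 2 / ‖x‖)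

/-! ### Real symmetric matrices with the Schatten `p`-norm -/

/-- The real vector space of real symmetric `d × d` matrices. -/
def symmetricMatrices (d : ℕ) : Submodule ℝ (Matrix (Fin d) (Fin d) ℝ) where
  carrier := {X | X.IsSymm}
  add_mem' hX hY := hX.add hY
  zero_mem' := Matrix.isSymm_zero
  smul_mem' c _ hX := hX.smul c

/-- The space of real symmetric `d × d` matrices, as a type that carries the Schatten `p`-norm. -/
def SchattenSym (d : ℕ) (_p : ℝ) : Type := symmetricMatrices d

namespace SchattenSym

variable {d : ℕ} {p : ℝ}

instance : AddCommGroup (SchattenSym d p) := inferInstanceAs (AddCommGroup (symmetricMatrices d))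

noncomputable instance : Module ℝ (SchattenSym d p) :=
  inferInstanceAs (Module ℝ (symmetricMatrices d))

instance : FiniteDimensional ℝ (SchattenSym d p) :=
  inferInstanceAs (FiniteDimensional ℝ (symmetricMatrices d))

/-- The underlying matrix. -/
def toMatrix (X : SchattenSym d p) : Matrix (Fin d) (Fin d) ℝ := Subtype.val (p := (· ∈ symmetricMatrices d)) X

theorem isHermitian (X : SchattenSym d p) : X.toMatrix.IsHermitian :=
  Matrix.conjTranspose_eq_transpose_of_trivial X.toMatrix |>.trans
    (Subtype.prop (p := (· ∈ symmetricMatrices d)) X)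

/-- The eigenvalues `λ_1(X), …, λ_d(X)`, with multiplicity. -/
noncomputable def eigenvalue (X : SchattenSym d p) (i : Fin d) : ℝ := X.isHermitian.eigenvalues i

/-- The Schatten `p`-norm `(∑ i, |λ_i(X)| ^ p) ^ (1 / p)`. -/
noncomputable instance : Norm (SchattenSym d p) where
  norm X := (∑ i, |X.eigenvalue i| ^ p) ^ (1 / p)

theorem norm_def (X : SchattenSym d p) : ‖X‖ = (∑ i, |X.eigenvalue i| ^ p) ^ (1 / p) := rfl

/-- `‖X‖ = (Tr (|X| ^ p)) ^ (1 / p)`, with `|X| ^ p` given by the functional calculus. -/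
theorem norm_eq_trace (X : SchattenSym d p) :
    ‖X‖ = (cfc (fun x : ℝ => |x| ^ p) X.toMatrix).trace ^ (1 / p) := by
  rw [norm_def, X.isHermitian.cfc_eq, Matrix.IsHermitian.cfc, Unitary.conjStarAlgAut_apply,
    Matrix.trace_mul_cycle]
  simp [Matrix.trace, eigenvalue]

/-- The quadratic form `v ↦ ⟨v, X v⟩`. -/
noncomputable def quad (X : SchattenSym d p) (v : EuclideanSpace ℝ (Fin d)) : ℝ :=
  inner ℝ v (Matrix.toEuclideanLin X.toMatrix v)

theorem quad_add (X Y : SchattenSym d p) (v : EuclideanSpace ℝ (Fin d)) :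
    (X + Y).quad v = X.quad v + Y.quad v := by
  have h : (X + Y).toMatrix = X.toMatrix + Y.toMatrix := rfl
  simp only [quad, h, map_add, LinearMap.add_apply, inner_add_right]

theorem quad_smul (c : ℝ) (X : SchattenSym d p) (v : EuclideanSpace ℝ (Fin d)) :
    (c • X).quad v = c * X.quad v := by
  have h : (c • X).toMatrix = c • X.toMatrix := rfl
  simp only [quad, h, map_smul, LinearMap.smul_apply, inner_smul_right]

theorem toEuclideanLin_eigenvector (X : SchattenSym d p) (i : Fin d) :
    Matrix.toEuclideanLin X.toMatrix (X.isHermitian.eigenvectorBasis i)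
      = X.eigenvalue i • X.isHermitian.eigenvectorBasis i := by
  have h := X.isHermitian.mulVec_eigenvectorBasis i
  ext j
  simpa [Matrix.toLpLin_apply, eigenvalue] using congrFun h j

theorem quad_eigenvector (X : SchattenSym d p) (i : Fin d) :
    X.quad (X.isHermitian.eigenvectorBasis i) = X.eigenvalue i := by
  rw [quad, toEuclideanLin_eigenvector, inner_smul_right, real_inner_self_eq_norm_sq,
    X.isHermitian.eigenvectorBasis.norm_eq_one]
  simp

theorem quad_eq_sum (X : SchattenSym d p) (v : EuclideanSpace ℝ (Fin d)) :
    X.quad v = ∑ j, inner ℝ (X.isHermitian.eigenvectorBasis j) v ^ 2 * X.eigenvalue j := by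
  rw [quad, ← X.isHermitian.eigenvectorBasis.sum_inner_mul_inner]
  refine Finset.sum_congr rfl fun j _ => ?_
  have hs := Matrix.isSymmetric_toEuclideanLin_iff.2 X.isHermitian
  have h : inner ℝ (X.isHermitian.eigenvectorBasis j) (Matrix.toEuclideanLin X.toMatrix v)
      = X.eigenvalue j * inner ℝ (X.isHermitian.eigenvectorBasis j) v := by
    rw [← hs, toEuclideanLin_eigenvector, real_inner_smul_left]
  rw [h, real_inner_comm]
  ring

theorem sum_quad_le (hp : 1 ≤ p) (X : SchattenSym d p)
    (b : OrthonormalBasis (Fin d) ℝ (EuclideanSpace ℝ (Fin d))) :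
    (∑ i, |X.quad (b i)| ^ p) ^ (1 / p) ≤ ‖X‖ := by
  have h1 : ∀ v : EuclideanSpace ℝ (Fin d),
      ∑ j, inner ℝ (X.isHermitian.eigenvectorBasis j) v ^ 2 = ‖v‖ ^ 2 := fun v => by
    simpa using X.isHermitian.eigenvectorBasis.sum_sq_norm_inner_right v
  have h2 : ∀ j, ∑ i, inner ℝ (X.isHermitian.eigenvectorBasis j) (b i) ^ 2 = 1 := fun j => by
    simpa using b.sum_sq_norm_inner_left (X.isHermitian.eigenvectorBasis j)
  rw [norm_def]
  refine Real.rpow_le_rpow (Finset.sum_nonneg fun i _ => by positivity) ?_ (by positivity)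
  calc ∑ i, |X.quad (b i)| ^ p
      ≤ ∑ i, ∑ j, inner ℝ (X.isHermitian.eigenvectorBasis j) (b i) ^ 2
          * |X.eigenvalue j| ^ p := by
        refine Finset.sum_le_sum fun i _ => ?_
        rw [quad_eq_sum]
        refine le_trans (Real.rpow_le_rpow (abs_nonneg _) (Finset.abs_sum_le_sum_abs _ _)
          (by linarith)) ?_
        simp only [abs_mul, abs_pow, sq_abs]
        refine Real.rpow_arith_mean_le_arith_mean_rpow _ _ _ (fun j _ => sq_nonneg _) ?_
          (fun j _ => abs_nonneg _) hp
        rw [h1, b.norm_eq_one, one_pow]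
    _ = ∑ j, |X.eigenvalue j| ^ p := by
        rw [Finset.sum_comm]
        refine Finset.sum_congr rfl fun j _ => ?_
        rw [← Finset.sum_mul, h2, one_mul]

theorem norm_add_le' (hp : 1 ≤ p) (X Y : SchattenSym d p) : ‖X + Y‖ ≤ ‖X‖ + ‖Y‖ := by
  refine le_trans ?_ (add_le_add (sum_quad_le hp X (X + Y).isHermitian.eigenvectorBasis)
    (sum_quad_le hp Y (X + Y).isHermitian.eigenvectorBasis))
  refine le_trans (le_of_eq ?_) (Real.Lp_add_le _ _ _ hp)
  rw [norm_def]
  simp only [← quad_add, quad_eigenvector]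

theorem norm_smul_le' (hp : 1 ≤ p) (c : ℝ) (X : SchattenSym d p) : ‖c • X‖ ≤ |c| * ‖X‖ := by
  have h0 : p ≠ 0 := by linarith
  refine le_trans (le_of_eq ?_) (mul_le_mul_of_nonneg_left
    (sum_quad_le hp X (c • X).isHermitian.eigenvectorBasis) (abs_nonneg c))
  rw [norm_def]
  simp only [← quad_eigenvector (c • X), quad_smul, abs_mul]
  simp only [Real.mul_rpow (abs_nonneg _) (abs_nonneg _), ← Finset.mul_sum]
  rw [Real.mul_rpow (by positivity) (Finset.sum_nonneg fun i _ => by positivity),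
    ← Real.rpow_mul (abs_nonneg c), mul_one_div_cancel h0, Real.rpow_one]

theorem norm_nonneg' (X : SchattenSym d p) : 0 ≤ ‖X‖ :=
  Real.rpow_nonneg (Finset.sum_nonneg fun i _ => by positivity) _

theorem norm_zero' (hp : 1 ≤ p) : ‖(0 : SchattenSym d p)‖ = 0 := by
  have h := norm_smul_le' hp 0 (0 : SchattenSym d p)
  rw [zero_smul, abs_zero, zero_mul] at h
  exact le_antisymm h (norm_nonneg' _)

theorem norm_neg' (hp : 1 ≤ p) (X : SchattenSym d p) : ‖-X‖ = ‖X‖ := by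
  have key : ∀ Y : SchattenSym d p, ‖-Y‖ ≤ ‖Y‖ := fun Y => by
    simpa using norm_smul_le' hp (-1) Y
  exact le_antisymm (key X) (by simpa using key (-X))

theorem eq_zero_of_norm_eq_zero (hp : 1 ≤ p) (X : SchattenSym d p) (h : ‖X‖ = 0) : X = 0 := by
  have h0 : p ≠ 0 := by linarith
  rw [norm_def, Real.rpow_eq_zero (Finset.sum_nonneg fun i _ => by positivity)
    (one_div_ne_zero h0), Finset.sum_eq_zero_iff_of_nonneg (fun i _ => by positivity)] at h
  have h1 : X.isHermitian.eigenvalues = 0 := by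
    funext i
    exact abs_eq_zero.1 ((Real.rpow_eq_zero (abs_nonneg _) h0).1 (h i (Finset.mem_univ i)))
  exact Subtype.ext (X.isHermitian.eigenvalues_eq_zero_iff.1 h1)

variable [hp : Fact (1 ≤ p)]

noncomputable instance : NormedAddCommGroup (SchattenSym d p) :=
  AddGroupNorm.toNormedAddCommGroup
    { toFun := fun X => ‖X‖
      map_zero' := norm_zero' hp.out
      add_le' := norm_add_le' hp.out
      neg' := norm_neg' hp.out
      eq_zero_of_map_eq_zero' := eq_zero_of_norm_eq_zero hp.out }

noncomputable instance : NormedSpace ℝ (SchattenSym d p) where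
  norm_smul_le := norm_smul_le' hp.out

theorem norm_eq (X : SchattenSym d p) :
    norm (self := NormedAddCommGroup.toNorm) X = (∑ i, |X.eigenvalue i| ^ p) ^ (1 / p) := rfl

instance : CompleteSpace (SchattenSym d p) := FiniteDimensional.complete ℝ _

end SchattenSym

/-!
For `X ≠ 0` the norm is `N(X) = (Tr |X| ^ p) ^ (1 / p)`, so the matter is the calculus of
`X ↦ Tr |X| ^ p` and of its gradient `g(X)`, where `g x = p |x| ^ (p - 2) x` is `C¹` as `p ≥ 2`.

The differentiability of a matrix function comes from an exact difference formula
(`Matrix.IsHermitian.cfc_sub_cfc`): if `λ_j`, `Q_j` are the eigenvalues and eigenprojections of `X`,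
then for every symmetric `A`
`g(A) - g(X) = ∑ j, h_j(A) (A - X) Q_j`, with `h_j = dslope g λ_j`.
Since `h_j` is continuous, so is `A ↦ h_j(A)`; with `A = X + t H` one divides by `t` and lets `t → 0`
(`Matrix.IsHermitian.hasDerivAt_cfc`). Taking traces gives `δ_H Tr f(X) = Tr (H f'(X))`, and
`Tr (H δ_H g(X)) = ∑ i j, h_j(λ_i) H_ij ^ 2` in an eigenvector basis of `X`.

The first bound holds because a norm is `1`-Lipschitz. For the second, the mean value theorem gives
`0 ≤ h_j(λ_i) ≤ p (p - 1) (|λ_i| ^ (p - 2) + |λ_j| ^ (p - 2))`, hence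
`0 ≤ Tr (H δ_H g(X)) ≤ 2 p (p - 1) ∑ j, |λ_j| ^ (p - 2) ‖H v_j‖ ^ 2`, where the `v_j` are the
eigenvectors, and by Hölder's inequality and `∑ j, ‖H v_j‖ ^ p ≤ ‖H‖_p ^ p`
(`SchattenSym.sum_norm_apply_rpow_le`) this is at most `2 p (p - 1) N(X) ^ (p - 2) ‖H‖_p ^ 2`. The chain
rule yields
`δ_{H,H} N = N ^ (1 - p) Tr (H δ_H g(X)) / p - (p - 1) (δ_H N) ^ 2 / N`,
a difference of two nonnegative numbers, the first at most `2 (p - 1) ‖H‖_p ^ 2 / N` and the second at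
most `(p - 1) ‖H‖_p ^ 2 / N`; so even the constant `2 (p - 1)` is valid.
-/

/-! ### Spectral projections and the functional calculus of a real symmetric matrix -/

namespace Matrix.IsHermitian

open Filter Topology
open scoped Matrix.Norms.L2Operator

variable {n : Type*} [Fintype n] [DecidableEq n] {X : Matrix n n ℝ}

/-- The orthogonal projection `v_j v_jᵀ` onto the line spanned by the `j`-th vector of the
eigenvector basis of a real symmetric matrix. -/
noncomputable def eigenproj (hX : X.IsHermitian) (j : n) : Matrix n n ℝ :=
  vecMulVec (hX.eigenvectorBasis j).ofLp (hX.eigenvectorBasis j).ofLp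

theorem cfc_eq_sum_eigenproj (hX : X.IsHermitian) (g : ℝ → ℝ) :
    _root_.cfc g X = ∑ j, g (hX.eigenvalues j) • hX.eigenproj j := by
  rw [hX.cfc_eq, Matrix.IsHermitian.cfc, Unitary.conjStarAlgAut_apply]
  ext a b
  simp [Matrix.mul_apply, Matrix.sum_apply, eigenproj, vecMulVec_apply, diagonal_apply]
  exact Finset.sum_congr rfl fun j _ => by ring

theorem sum_eigenproj (hX : X.IsHermitian) : ∑ j, hX.eigenproj j = 1 := by
  have h := hX.cfc_eq_sum_eigenproj fun _ => 1
  rw [cfc_const_one ℝ X hX.isSelfAdjoint] at h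
  simpa using h.symm

theorem eigenproj_mul_eigenproj (hX : X.IsHermitian) (i j : n) :
    hX.eigenproj i * hX.eigenproj j = if i = j then hX.eigenproj j else 0 := by
  have h : (hX.eigenvectorBasis i).ofLp ⬝ᵥ (hX.eigenvectorBasis j).ofLp
      = if i = j then 1 else 0 := by
    have := orthonormal_iff_ite.1 hX.eigenvectorBasis.orthonormal j i
    simpa [EuclideanSpace.inner_eq_star_dotProduct, eq_comm] using this
  rw [eigenproj, eigenproj, vecMulVec_mul_vecMulVec, h]
  split_ifs with hij
  · simp [hij]
  · simp

theorem cfc_mul_eigenproj (hX : X.IsHermitian) (g : ℝ → ℝ) (j : n) :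
    _root_.cfc g X * hX.eigenproj j = g (hX.eigenvalues j) • hX.eigenproj j := by
  simp [hX.cfc_eq_sum_eigenproj, Finset.sum_mul, eigenproj_mul_eigenproj]

theorem eigenproj_mul_cfc (hX : X.IsHermitian) (g : ℝ → ℝ) (j : n) :
    hX.eigenproj j * _root_.cfc g X = g (hX.eigenvalues j) • hX.eigenproj j := by
  simp [hX.cfc_eq_sum_eigenproj, Finset.mul_sum, eigenproj_mul_eigenproj]

theorem mul_eigenproj (hX : X.IsHermitian) (j : n) :
    X * hX.eigenproj j = hX.eigenvalues j • hX.eigenproj j := by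
  simpa [cfc_id' ℝ X hX.isSelfAdjoint] using hX.cfc_mul_eigenproj (fun x => x) j

/-! ### Differentiability of the functional calculus -/

/-- The derivative of `X ↦ cfc g X` in the direction `H`: in an eigenvector basis of `X` the entry
`H i j` is multiplied by the divided difference of `g` at the eigenvalues `i` and `j`, with
`deriv g` on the diagonal. -/
noncomputable def cfcDeriv (hX : X.IsHermitian) (g : ℝ → ℝ) : Matrix n n ℝ →ₗ[ℝ] Matrix n n ℝ :=
  ∑ j, (LinearMap.mulRight ℝ (hX.eigenproj j)).comp
    (LinearMap.mulLeft ℝ (_root_.cfc (dslope g (hX.eigenvalues j)) X))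

theorem cfcDeriv_apply (hX : X.IsHermitian) (g : ℝ → ℝ) (H : Matrix n n ℝ) :
    hX.cfcDeriv g H
      = ∑ j, _root_.cfc (dslope g (hX.eigenvalues j)) X * H * hX.eigenproj j := by
  simp [cfcDeriv]

theorem _root_.Differentiable.continuous_dslope {g : ℝ → ℝ} (hg : Differentiable ℝ g) (a : ℝ) :
    Continuous (dslope g a) := by
  rw [← continuousOn_univ, continuousOn_dslope univ_mem]
  exact ⟨hg.continuous.continuousOn, hg a⟩

/-- An exact difference formula: on the range of the `j`-th eigenprojection of `X` the matrix
`cfc g X` is the scalar `g (λ_j)`, and `g - g (λ_j)` is the product of `dslope g λ_j` and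
`x ↦ x - λ_j`. -/
theorem cfc_sub_cfc {A : Matrix n n ℝ} (hX : X.IsHermitian) (hA : A.IsHermitian) {g : ℝ → ℝ}
    (hg : Differentiable ℝ g) :
    _root_.cfc g A - _root_.cfc g X
      = ∑ j, _root_.cfc (dslope g (hX.eigenvalues j)) A * (A - X) * hX.eigenproj j := by
  have hA' : IsSelfAdjoint A := hA.isSelfAdjoint
  rw [← mul_one (_root_.cfc g A - _root_.cfc g X), ← hX.sum_eigenproj, Finset.mul_sum]
  refine Finset.sum_congr rfl fun j _ => ?_
  set μ := hX.eigenvalues j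
  have h1 : _root_.cfc (dslope g μ) A * (A - algebraMap ℝ _ μ)
      = _root_.cfc g A - algebraMap ℝ _ (g μ) := by
    have hc := hg.continuous_dslope μ
    have hc' := hg.continuous
    have hs : A - algebraMap ℝ _ μ = _root_.cfc (fun x => x - μ) A := by
      rw [cfc_sub (fun x => x) (fun _ => μ) A, cfc_id' ℝ A hA', cfc_const μ A hA']
    rw [hs, ← cfc_const (g μ) A hA', ← cfc_sub g (fun _ => g μ) A]
    rw [← cfc_mul (dslope g μ) (fun x => x - μ) A]
    congr 1
    funext x
    rw [mul_comm]
    exact sub_smul_dslope g μ x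
  have h2 : (A - X) * hX.eigenproj j = (A - algebraMap ℝ _ μ) * hX.eigenproj j := by
    rw [sub_mul, sub_mul, hX.mul_eigenproj, Algebra.algebraMap_eq_smul_one, smul_mul_assoc,
      one_mul]
  have h3 : (_root_.cfc g A - _root_.cfc g X) * hX.eigenproj j
      = (_root_.cfc g A - algebraMap ℝ _ (g μ)) * hX.eigenproj j := by
    rw [sub_mul, sub_mul, hX.cfc_mul_eigenproj, Algebra.algebraMap_eq_smul_one, smul_mul_assoc,
      one_mul]
  rw [h3, mul_assoc, h2, ← mul_assoc, h1]

theorem hasDerivAt_cfc {H : Matrix n n ℝ} (hX : X.IsHermitian) (hH : H.IsHermitian)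
    {g : ℝ → ℝ} (hg : Differentiable ℝ g) :
    HasDerivAt (fun t : ℝ => _root_.cfc g (X + t • H)) (hX.cfcDeriv g H) 0 := by
  have hA : ∀ t : ℝ, (X + t • H).IsHermitian := fun t => by
    rw [IsHermitian, conjTranspose_add, conjTranspose_smul, hX.eq, hH.eq, star_trivial]
  have hc : ∀ j, Continuous fun t : ℝ =>
      _root_.cfc (dslope g (hX.eigenvalues j)) (X + t • H) := fun j =>
    Continuous.cfc_of_mem_nhdsSet (s := Set.univ) _ univ_mem (by fun_prop)
      (fun t => (hA t).isSelfAdjoint) (hg.continuous_dslope _).continuousOn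
  have hlim : Continuous fun t : ℝ => ∑ j,
      _root_.cfc (dslope g (hX.eigenvalues j)) (X + t • H) * H * hX.eigenproj j :=
    continuous_finsetSum _ fun j _ => ((hc j).mul continuous_const).mul continuous_const
  rw [hasDerivAt_iff_tendsto_slope, cfcDeriv_apply]
  have h0 := (hlim.tendsto 0).mono_left (nhdsWithin_le_nhds (s := {0}ᶜ))
  simp only [zero_smul, add_zero] at h0
  refine h0.congr' ?_
  filter_upwards [self_mem_nhdsWithin] with t ht
  rw [slope_def_module, zero_smul, add_zero, hX.cfc_sub_cfc (hA t) hg, add_sub_cancel_left,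
    sub_zero]
  simp only [mul_smul_comm, smul_mul_assoc, ← Finset.smul_sum]
  rw [smul_smul, inv_mul_cancel₀ ht, one_smul]

theorem trace_cfcDeriv (hX : X.IsHermitian) (g : ℝ → ℝ) (H : Matrix n n ℝ) :
    (hX.cfcDeriv g H).trace = (H * _root_.cfc (deriv g) X).trace := by
  rw [cfcDeriv_apply, trace_sum, hX.cfc_eq_sum_eigenproj, Finset.mul_sum, trace_sum]
  refine Finset.sum_congr rfl fun j _ => ?_
  rw [mul_assoc, trace_mul_comm, mul_assoc, hX.eigenproj_mul_cfc, dslope_same]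

theorem hasDerivAt_trace_cfc {H : Matrix n n ℝ} (hX : X.IsHermitian) (hH : H.IsHermitian)
    {g : ℝ → ℝ} (hg : Differentiable ℝ g) :
    HasDerivAt (fun t : ℝ => (_root_.cfc g (X + t • H)).trace)
      (H * _root_.cfc (deriv g) X).trace 0 := by
  rw [← hX.trace_cfcDeriv]
  exact (LinearMap.toContinuousLinearMap
    (traceLinearMap n ℝ ℝ)).hasFDerivAt.comp_hasDerivAt 0 (hX.hasDerivAt_cfc hH hg)

theorem trace_mul_cfcDeriv (hX : X.IsHermitian) {H : Matrix n n ℝ} (hH : H.IsHermitian)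
    (g : ℝ → ℝ) :
    (H * hX.cfcDeriv g H).trace
      = ∑ j, ∑ i, dslope g (hX.eigenvalues j) (hX.eigenvalues i)
          * inner ℝ (hX.eigenvectorBasis i) (toEuclideanLin H (hX.eigenvectorBasis j)) ^ 2 := by
  rw [cfcDeriv_apply, Finset.mul_sum, trace_sum]
  refine Finset.sum_congr rfl fun j _ => ?_
  rw [hX.cfc_eq_sum_eigenproj, Finset.sum_mul, Finset.sum_mul, Finset.mul_sum, trace_sum]
  refine Finset.sum_congr rfl fun i _ => ?_
  rw [smul_mul_assoc, smul_mul_assoc, mul_smul_comm, trace_smul, smul_eq_mul]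
  congr 1
  set v := (hX.eigenvectorBasis i).ofLp
  set w := (hX.eigenvectorBasis j).ofLp
  have hin : inner ℝ (hX.eigenvectorBasis i) (toEuclideanLin H (hX.eigenvectorBasis j))
      = v ⬝ᵥ H *ᵥ w := by
    rw [EuclideanSpace.inner_eq_star_dotProduct, dotProduct_comm]
    simp [v, w, toLpLin_apply]
  have hsymm : w ⬝ᵥ H *ᵥ v = v ⬝ᵥ H *ᵥ w := by
    have hT : Hᵀ = H := by simpa using hH.eq
    rw [dotProduct_mulVec, ← mulVec_transpose, hT, dotProduct_comm]
  have h1 : eigenproj hX i = vecMulVec v v := rfl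
  have h2 : eigenproj hX j = vecMulVec w w := rfl
  rw [hin, h1, h2, vecMulVec_mul, vecMulVec_mul_vecMulVec, mul_vecMulVec, trace_vecMulVec,
    ← dotProduct_mulVec, dotProduct_smul, dotProduct_comm (H *ᵥ v), hsymm, smul_eq_mul, sq]

end Matrix.IsHermitian

/-! ### The scalar function `|x| ^ p` -/

/-- At `0` the derivative is the limit of `|x| ^ (p - 2)`, which equals `(p - 1) * 0 ^ (p - 2)`:
both vanish for `p > 2`, and both are `1` for `p = 2` since `0 ^ 0 = 1`. -/
theorem hasDerivAt_mul_abs_rpow_mul {p : ℝ} (hp : 2 ≤ p) (x : ℝ) :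
    HasDerivAt (fun x : ℝ => p * |x| ^ (p - 2) * x) (p * (p - 1) * |x| ^ (p - 2)) x := by
  rcases eq_or_ne x 0 with rfl | hx
  · rw [hasDerivAt_iff_tendsto_slope]
    have hc : Continuous fun x : ℝ => p * |x| ^ (p - 2) :=
      continuous_const.mul (continuous_abs.rpow_const fun _ => Or.inr (by linarith))
    have h0 := (hc.tendsto 0).mono_left (nhdsWithin_le_nhds (s := {0}ᶜ))
    have he : p * (p - 1) * |(0 : ℝ)| ^ (p - 2) = p * |(0 : ℝ)| ^ (p - 2) := by
      rcases hp.eq_or_lt with rfl | h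
      · norm_num
      · simp [Real.zero_rpow (sub_pos.2 h).ne']
    rw [he]
    refine h0.congr' ?_
    filter_upwards [self_mem_nhdsWithin] with t ht
    rw [slope_def_field, mul_zero, sub_zero, sub_zero, mul_div_cancel_right₀ _ ht]
  · have h := (((hasDerivAt_abs hx).rpow_const (p := p - 2)
      (Or.inl (abs_ne_zero.2 hx))).const_mul p).mul (hasDerivAt_id x)
    refine h.congr_deriv ?_
    have hs : (SignType.sign x : ℝ) * x = |x| := by
      rw [mul_comm, self_mul_sign]
    have hr : |x| ^ (p - 2 - 1) * |x| = |x| ^ (p - 2) := by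
      rw [Real.rpow_sub_one (abs_ne_zero.2 hx), div_mul_cancel₀ _ (abs_ne_zero.2 hx)]
    simp only [id]
    linear_combination (p * (p - 2) * |x| ^ (p - 2 - 1)) * hs + p * (p - 2) * hr

theorem deriv_abs_rpow {p : ℝ} (hp : 1 < p) :
    deriv (fun x : ℝ => |x| ^ p) = fun x => p * |x| ^ (p - 2) * x :=
  funext fun x => (hasDerivAt_abs_rpow x hp).deriv

theorem exists_dslope_eq_deriv {g : ℝ → ℝ} (hg : Differentiable ℝ g) (a b : ℝ) :
    ∃ c ∈ Set.uIcc a b, dslope g a b = deriv g c := by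
  rcases lt_trichotomy a b with h | rfl | h
  · obtain ⟨c, hc, he⟩ := exists_deriv_eq_slope g h hg.continuous.continuousOn
      hg.differentiableOn
    refine ⟨c, Set.Icc_subset_uIcc (Set.Ioo_subset_Icc_self hc), ?_⟩
    rw [dslope_of_ne _ h.ne', slope_def_field, he]
  · exact ⟨a, Set.left_mem_uIcc, dslope_same g a⟩
  · obtain ⟨c, hc, he⟩ := exists_deriv_eq_slope g h hg.continuous.continuousOn
      hg.differentiableOn
    refine ⟨c, Set.Icc_subset_uIcc' (Set.Ioo_subset_Icc_self hc), ?_⟩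
    rw [dslope_of_ne _ h.ne, slope_comm, slope_def_field, he]

theorem dslope_mul_abs_rpow_mul_bounds {p : ℝ} (hp : 2 ≤ p) (a b : ℝ) :
    0 ≤ dslope (fun x : ℝ => p * |x| ^ (p - 2) * x) a b ∧
      dslope (fun x : ℝ => p * |x| ^ (p - 2) * x) a b
        ≤ p * (p - 1) * (|a| ^ (p - 2) + |b| ^ (p - 2)) := by
  obtain ⟨c, hc, he⟩ := exists_dslope_eq_deriv
    (fun x => (hasDerivAt_mul_abs_rpow_mul hp x).differentiableAt) a b
  have hpp : 0 ≤ p * (p - 1) := mul_nonneg (by linarith) (by linarith)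
  rw [he, (hasDerivAt_mul_abs_rpow_mul hp c).deriv]
  refine ⟨by positivity, mul_le_mul_of_nonneg_left ?_ hpp⟩
  have hcm : |c| ≤ max |a| |b| := by
    rcases Set.mem_uIcc.1 hc with h | h
    · exact abs_le_max_abs_abs h.1 h.2
    · exact max_comm |a| |b| ▸ abs_le_max_abs_abs h.1 h.2
  rcases le_max_iff.1 hcm with h | h
  · have := Real.rpow_le_rpow (abs_nonneg c) h (sub_nonneg.2 hp)
    linarith [Real.rpow_nonneg (abs_nonneg b) (p - 2)]
  · have := Real.rpow_le_rpow (abs_nonneg c) h (sub_nonneg.2 hp)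
    linarith [Real.rpow_nonneg (abs_nonneg a) (p - 2)]

theorem sq_rpow_div_two {x : ℝ} (hx : 0 ≤ x) (p : ℝ) : (x ^ 2) ^ (p / 2) = x ^ p := by
  rw [← Real.rpow_natCast, ← Real.rpow_mul hx]
  congr 1
  push_cast
  ring

/-- Hölder's inequality with the exponents `p / (p - 2)` and `p / 2`; for `p = 2` the first exponent
is infinite and the claim is the hypothesis on `b`. -/
theorem sum_rpow_sub_two_mul_sq_le {ι : Type*} [Fintype ι] {p : ℝ} (hp : 2 ≤ p) (a b : ι → ℝ)
    (ha : ∀ i, 0 ≤ a i) (hb : ∀ i, 0 ≤ b i) {A B : ℝ} (hA : 0 ≤ A) (hB : 0 ≤ B)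
    (haA : ∑ i, a i ^ p ≤ A ^ p) (hbB : ∑ i, b i ^ p ≤ B ^ p) :
    ∑ i, a i ^ (p - 2) * b i ^ 2 ≤ A ^ (p - 2) * B ^ 2 := by
  rcases hp.eq_or_lt with rfl | h
  · simpa using hbB
  have hp0 : p ≠ 0 := by linarith
  have hq : p - 2 ≠ 0 := (sub_pos.2 h).ne'
  have hpq : (p / (p - 2)).HolderConjugate (p / 2) := by
    rw [Real.holderConjugate_iff]
    refine ⟨(one_lt_div (sub_pos.2 h)).2 (by linarith), ?_⟩
    field_simp
    ring
  refine (Real.inner_le_Lp_mul_Lq_of_nonneg Finset.univ hpq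
    (fun i _ => Real.rpow_nonneg (ha i) _) (fun i _ => sq_nonneg _)).trans ?_
  have e1 : ∀ x : ℝ, 0 ≤ x → (x ^ (p - 2)) ^ (p / (p - 2)) = x ^ p := fun x hx => by
    rw [← Real.rpow_mul hx, mul_div_cancel₀ _ hq]
  simp only [e1 _ (ha _), sq_rpow_div_two (hb _)]
  have hs : ∀ c : ι → ℝ, (∀ i, 0 ≤ c i) → 0 ≤ ∑ i, c i ^ p := fun c hc =>
    Finset.sum_nonneg fun i _ => Real.rpow_nonneg (hc i) _
  refine mul_le_mul ?_ ?_ (Real.rpow_nonneg (hs b hb) _) (Real.rpow_nonneg hA _)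
  · refine (Real.rpow_le_rpow (hs a ha) haA (by rw [one_div]; exact hpq.inv_nonneg)).trans_eq ?_
    rw [← Real.rpow_mul hA]
    congr 1
    field_simp
  · refine (Real.rpow_le_rpow (hs b hb) hbB (by positivity)).trans_eq ?_
    rw [← Real.rpow_mul hB, ← Real.rpow_natCast]
    congr 1
    push_cast
    field_simp

/-! ### First and second Gateaux differentials of the Schatten norm -/

section Gateaux

variable {E F : Type*} [NormedAddCommGroup E] [NormedSpace ℝ E]
  [NormedAddCommGroup F] [NormedSpace ℝ F]

theorem eventually_nhds_add_smul {P : E → Prop} {x : E} (h : ∀ᶠ y in nhds x, P y) (v : E) :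
    ∀ᶠ t : ℝ in nhds 0, P (x + t • v) := by
  have hc : Continuous fun t : ℝ => x + t • v := by fun_prop
  have := hc.tendsto 0
  rw [zero_smul, add_zero] at this
  exact this.eventually h

theorem secondGateauxDifferential_eq {f : E → ℝ} {f' : E → E →L[ℝ] ℝ} {f'' : E →L[ℝ] E →L[ℝ] ℝ}
    {x : E} (hf : ∀ᶠ y in nhds x, HasGateauxDerivAt f (f' y) y) (hf' : HasGateauxDerivAt f' f'' x)
    (u v : E) : secondGateauxDifferential u v f x = f'' u v := by
  have h : HasDerivAt (fun t : ℝ => f' (x + t • u) v) (f'' u v) 0 :=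
    (ContinuousLinearMap.apply ℝ ℝ v).hasFDerivAt.comp_hasDerivAt 0 (hf' u)
  refine (h.congr_of_eventuallyEq ?_).deriv
  filter_upwards [eventually_nhds_add_smul hf u] with t ht
  exact (ht v).lineDeriv

end Gateaux

namespace SchattenSym

open Matrix

variable {d : ℕ} {p : ℝ}

/-- The inclusion into all matrices as a linear map. -/
def toMatrixLM (d : ℕ) (p : ℝ) : SchattenSym d p →ₗ[ℝ] Matrix (Fin d) (Fin d) ℝ :=
  (symmetricMatrices d).subtype

theorem toMatrixLM_apply (X : SchattenSym d p) : toMatrixLM d p X = X.toMatrix := rfl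

theorem trace_cfc_abs_rpow (X : SchattenSym d p) :
    (cfc (fun x : ℝ => |x| ^ p) X.toMatrix).trace = ∑ i, |X.eigenvalue i| ^ p := by
  rw [X.isHermitian.cfc_eq, Matrix.IsHermitian.cfc, Unitary.conjStarAlgAut_apply,
    Matrix.trace_mul_cycle]
  simp [Matrix.trace, eigenvalue]

theorem inner_eigenvector_toEuclideanLin (H : SchattenSym d p) (v : EuclideanSpace ℝ (Fin d))
    (k : Fin d) :
    inner ℝ (H.isHermitian.eigenvectorBasis k) (toEuclideanLin H.toMatrix v)
      = H.eigenvalue k * inner ℝ (H.isHermitian.eigenvectorBasis k) v := by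
  have hs := Matrix.isSymmetric_toEuclideanLin_iff.2 H.isHermitian
  rw [← hs, toEuclideanLin_eigenvector, real_inner_smul_left]

/-- `∑ j, ‖H b_j‖ ^ p ≤ ‖H‖_p ^ p` for every orthonormal basis `b`: the numbers `‖H b_j‖ ^ 2` are
doubly stochastic averages of the squared eigenvalues, and `x ↦ x ^ (p / 2)` is convex. -/
theorem sum_norm_apply_rpow_le (hp : 2 ≤ p) (H : SchattenSym d p)
    (b : OrthonormalBasis (Fin d) ℝ (EuclideanSpace ℝ (Fin d))) :
    ∑ j, ‖toEuclideanLin H.toMatrix (b j)‖ ^ p ≤ ∑ k, |H.eigenvalue k| ^ p := by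
  set w := H.isHermitian.eigenvectorBasis
  have h1 : ∀ v : EuclideanSpace ℝ (Fin d), ∑ k, inner ℝ (w k) v ^ 2 = ‖v‖ ^ 2 := fun v => by
    simpa using w.sum_sq_norm_inner_right v
  have h2 : ∀ k, ∑ j, inner ℝ (w k) (b j) ^ 2 = 1 := fun k => by
    simpa using b.sum_sq_norm_inner_left (w k)
  calc ∑ j, ‖toEuclideanLin H.toMatrix (b j)‖ ^ p
      ≤ ∑ j, ∑ k, inner ℝ (w k) (b j) ^ 2 * |H.eigenvalue k| ^ p := by
        refine Finset.sum_le_sum fun j _ => ?_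
        have hn : ‖toEuclideanLin H.toMatrix (b j)‖ ^ 2
            = ∑ k, inner ℝ (w k) (b j) ^ 2 * |H.eigenvalue k| ^ 2 := by
          rw [← h1]
          refine Finset.sum_congr rfl fun k _ => ?_
          rw [inner_eigenvector_toEuclideanLin, sq_abs]
          ring
        rw [← sq_rpow_div_two (norm_nonneg _), hn]
        refine (Real.rpow_arith_mean_le_arith_mean_rpow _ _ _ (fun k _ => sq_nonneg _) ?_
          (fun k _ => sq_nonneg _) (by linarith : 1 ≤ p / 2)).trans_eq ?_
        · rw [h1, b.norm_eq_one, one_pow]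
        · simp only [sq_rpow_div_two (abs_nonneg _)]
    _ = ∑ k, |H.eigenvalue k| ^ p := by
        rw [Finset.sum_comm]
        refine Finset.sum_congr rfl fun k _ => ?_
        rw [← Finset.sum_mul, h2, one_mul]

/-- The gradient `p |X| ^ (p - 2) X` of `X ↦ Tr (|X| ^ p)`. -/
noncomputable def gradPow (X : SchattenSym d p) : Matrix (Fin d) (Fin d) ℝ :=
  cfc (fun x : ℝ => p * |x| ^ (p - 2) * x) X.toMatrix

/-- The derivative of `gradPow` at `X`. -/
noncomputable def gradPowDeriv (X : SchattenSym d p) :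
    SchattenSym d p →ₗ[ℝ] Matrix (Fin d) (Fin d) ℝ :=
  X.isHermitian.cfcDeriv (fun x : ℝ => p * |x| ^ (p - 2) * x) ∘ₗ toMatrixLM d p

open scoped Matrix.Norms.L2Operator in
theorem hasLineDerivAt_gradPow (hp : 2 ≤ p) (X H : SchattenSym d p) :
    HasLineDerivAt ℝ gradPow (gradPowDeriv X H) X H :=
  X.isHermitian.hasDerivAt_cfc H.isHermitian fun x =>
    (hasDerivAt_mul_abs_rpow_mul hp x).differentiableAt

variable [hp1 : Fact (1 ≤ p)]

theorem norm_rpow_eq_sum (X : SchattenSym d p) : ‖X‖ ^ p = ∑ i, |X.eigenvalue i| ^ p := by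
  have h0 : p ≠ 0 := by linarith [hp1.out]
  rw [norm_eq, ← Real.rpow_mul (Finset.sum_nonneg fun i _ => by positivity),
    one_div_mul_cancel h0, Real.rpow_one]

/-- The functional `H ↦ Tr (H M)` attached to a matrix `M`. -/
noncomputable def traceDual (d : ℕ) (p : ℝ) [Fact (1 ≤ p)] :
    Matrix (Fin d) (Fin d) ℝ →ₗ[ℝ] (SchattenSym d p →L[ℝ] ℝ) :=
  LinearMap.toContinuousLinearMap.toLinearMap ∘ₗ LinearMap.mk₂ ℝ
    (fun (M : Matrix (Fin d) (Fin d) ℝ) (H : SchattenSym d p) => (H.toMatrix * M).trace)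
    (fun M N H => by rw [mul_add, trace_add])
    (fun c M H => by rw [mul_smul_comm, trace_smul])
    (fun M H K => by rw [← toMatrixLM_apply, map_add, add_mul, trace_add]; rfl)
    (fun c M H => by rw [← toMatrixLM_apply, map_smul, smul_mul_assoc, trace_smul]; rfl)

theorem traceDual_apply (M : Matrix (Fin d) (Fin d) ℝ) (H : SchattenSym d p) :
    traceDual d p M H = (H.toMatrix * M).trace := rfl

/-- The derivative `H ↦ (1 / p) ‖X‖ ^ (1 - p) Tr (H g(X))` of the norm at `X ≠ 0`, where
`g x = p |x| ^ (p - 2) x`. -/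
noncomputable def normDeriv (X : SchattenSym d p) : SchattenSym d p →L[ℝ] ℝ :=
  (1 / p * ‖X‖ ^ (1 - p)) • traceDual d p (gradPow X)

theorem hasGateauxDerivAt_norm (hp : 2 ≤ p) {X : SchattenSym d p} (hX : X ≠ 0) :
    HasGateauxDerivAt (fun Y : SchattenSym d p => ‖Y‖) (normDeriv X) X := by
  intro H
  have h0 : p ≠ 0 := by linarith
  have hpos : 0 < ‖X‖ := norm_pos_iff.2 hX
  have h1 : HasDerivAt (fun t : ℝ => ‖X + t • H‖ ^ p) (traceDual d p (gradPow X) H) 0 := by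
    have h := X.isHermitian.hasDerivAt_trace_cfc H.isHermitian
      fun x => (hasDerivAt_abs_rpow x (by linarith : 1 < p)).differentiableAt
    rw [deriv_abs_rpow (by linarith)] at h
    refine h.congr_of_eventuallyEq (Filter.Eventually.of_forall fun t => ?_)
    exact (norm_rpow_eq_sum _).trans (trace_cfc_abs_rpow (X + t • H)).symm
  have h2 := h1.rpow_const (p := 1 / p) (Or.inl (by rw [zero_smul, add_zero]; positivity))
  refine (h2.congr_of_eventuallyEq (Filter.Eventually.of_forall fun t => ?_)).congr_deriv ?_
  · simp only
    rw [← Real.rpow_mul (norm_nonneg _), mul_one_div_cancel h0, Real.rpow_one]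
  · rw [zero_smul, add_zero, ← Real.rpow_mul hpos.le, normDeriv, _root_.smul_apply,
      smul_eq_mul, show p * (1 / p - 1) = 1 - p by field_simp]
    ring

/-- The derivative of `normDeriv` at `X ≠ 0`, by the product rule for `‖X‖ ^ (1 - p)` and
`gradPow X`. -/
noncomputable def normSecondDeriv (X : SchattenSym d p) :
    SchattenSym d p →L[ℝ] SchattenSym d p →L[ℝ] ℝ :=
  (1 / p * ‖X‖ ^ (1 - p)) •
      LinearMap.toContinuousLinearMap (traceDual d p ∘ₗ gradPowDeriv X)
    + ((1 - p) / p * ‖X‖ ^ (-p)) • (normDeriv X).smulRight (traceDual d p (gradPow X))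

open scoped Matrix.Norms.L2Operator in
theorem hasGateauxDerivAt_normDeriv (hp : 2 ≤ p) {X : SchattenSym d p} (hX : X ≠ 0) :
    HasGateauxDerivAt normDeriv (normSecondDeriv X) X := by
  intro H
  have hN : HasDerivAt (fun t : ℝ => ‖X + t • H‖) (normDeriv X H) 0 :=
    hasGateauxDerivAt_norm hp hX H
  have hs := (hN.rpow_const (p := 1 - p)
    (Or.inl (by rw [zero_smul, add_zero]; exact norm_ne_zero_iff.2 hX))).const_mul (1 / p)
  have hT : HasDerivAt (fun t : ℝ => traceDual d p (gradPow (X + t • H)))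
      (traceDual d p (gradPowDeriv X H)) 0 :=
    (LinearMap.toContinuousLinearMap (traceDual d p)).hasFDerivAt.comp_hasDerivAt 0
      (hasLineDerivAt_gradPow hp X H)
  refine (hs.smul hT).congr_deriv ?_
  rw [zero_smul, add_zero, show 1 - p - 1 = -p by ring]
  ext K
  simp only [normSecondDeriv, _root_.add_apply, _root_.smul_apply,
    ContinuousLinearMap.smulRight_apply, LinearMap.coe_toContinuousLinearMap', smul_eq_mul,
    LinearMap.comp_apply]
  ring

/-- In an eigenvector basis of `X` the left side is `∑ i j, h_j(λ_i) H_ij ^ 2`; the divided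
differences are bounded by `p (p - 1) (|λ_i| ^ (p - 2) + |λ_j| ^ (p - 2))`, and by the symmetry of
`H_ij ^ 2` both summands contribute the same. -/
theorem traceDual_gradPowDeriv_bounds (hp : 2 ≤ p) (X H : SchattenSym d p) :
    0 ≤ traceDual d p (gradPowDeriv X H) H ∧
      traceDual d p (gradPowDeriv X H) H ≤ 2 * (p * (p - 1)) * (‖X‖ ^ (p - 2) * ‖H‖ ^ 2) := by
  have hpp : 0 ≤ p * (p - 1) := mul_nonneg (by linarith) (by linarith)
  set v := X.isHermitian.eigenvectorBasis
  set c : Fin d → Fin d → ℝ := fun i j => inner ℝ (v i) (toEuclideanLin H.toMatrix (v j)) ^ 2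
  have hc0 : ∀ i j, 0 ≤ c i j := fun i j => sq_nonneg _
  have hcs : ∀ i j, c i j = c j i := fun i j => by
    simp only [c]
    rw [← Matrix.isSymmetric_toEuclideanLin_iff.2 H.isHermitian, real_inner_comm]
  have hc1 : ∀ j, ∑ i, c i j = ‖toEuclideanLin H.toMatrix (v j)‖ ^ 2 := fun j => by
    simpa using v.sum_sq_norm_inner_right (toEuclideanLin H.toMatrix (v j))
  have he : traceDual d p (gradPowDeriv X H) H = ∑ j, ∑ i,
      dslope (fun x : ℝ => p * |x| ^ (p - 2) * x) (X.eigenvalue j) (X.eigenvalue i) * c i j :=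
    X.isHermitian.trace_mul_cfcDeriv H.isHermitian _
  have hS : ∑ j, |X.eigenvalue j| ^ (p - 2) * ‖toEuclideanLin H.toMatrix (v j)‖ ^ 2
      ≤ ‖X‖ ^ (p - 2) * ‖H‖ ^ 2 :=
    sum_rpow_sub_two_mul_sq_le hp _ _ (fun _ => abs_nonneg _) (fun _ => norm_nonneg _)
      (norm_nonneg _) (norm_nonneg _) (norm_rpow_eq_sum X).ge
      ((sum_norm_apply_rpow_le hp H v).trans_eq (norm_rpow_eq_sum H).symm)
  rw [he]
  refine ⟨Finset.sum_nonneg fun j _ => Finset.sum_nonneg fun i _ =>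
    mul_nonneg (dslope_mul_abs_rpow_mul_bounds hp _ _).1 (hc0 i j), ?_⟩
  calc ∑ j, ∑ i,
        dslope (fun x : ℝ => p * |x| ^ (p - 2) * x) (X.eigenvalue j) (X.eigenvalue i) * c i j
      ≤ ∑ j, ∑ i, p * (p - 1) * (|X.eigenvalue j| ^ (p - 2) + |X.eigenvalue i| ^ (p - 2))
          * c i j :=
        Finset.sum_le_sum fun j _ => Finset.sum_le_sum fun i _ =>
          mul_le_mul_of_nonneg_right (dslope_mul_abs_rpow_mul_bounds hp _ _).2 (hc0 i j)
    _ = p * (p - 1) * (∑ j, ∑ i, |X.eigenvalue j| ^ (p - 2) * c i j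
          + ∑ j, ∑ i, |X.eigenvalue i| ^ (p - 2) * c i j) := by
        simp only [mul_add, add_mul, Finset.sum_add_distrib, Finset.mul_sum, mul_assoc]
    _ = 2 * (p * (p - 1)) *
          ∑ j, |X.eigenvalue j| ^ (p - 2) * ‖toEuclideanLin H.toMatrix (v j)‖ ^ 2 := by
        have hsw : ∑ j, ∑ i, |X.eigenvalue i| ^ (p - 2) * c i j
            = ∑ j, ∑ i, |X.eigenvalue j| ^ (p - 2) * c i j := by
          rw [Finset.sum_comm]
          exact Finset.sum_congr rfl fun i _ => Finset.sum_congr rfl fun j _ => by rw [hcs]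
        rw [hsw]
        simp only [← Finset.mul_sum, hc1]
        ring
    _ ≤ _ := mul_le_mul_of_nonneg_left hS (by linarith)

theorem abs_normDeriv_le (hp : 2 ≤ p) {X : SchattenSym d p} (hX : X ≠ 0) (H : SchattenSym d p) :
    |normDeriv X H| ≤ ‖H‖ := by
  simpa using (hasGateauxDerivAt_norm hp hX H).le_of_lipschitz lipschitzWith_one_norm

/-- With `a = δ_H ‖X‖` and `q = Tr (H δ_H g(X))`, where `g x = p |x| ^ (p - 2) x`, the second
differential of the norm is `‖X‖ ^ (1 - p) q / p - (p - 1) a ^ 2 / ‖X‖`, a difference of two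
nonnegative terms. -/
theorem abs_normSecondDeriv_le (hp : 2 ≤ p) {X : SchattenSym d p} (hX : X ≠ 0)
    (H : SchattenSym d p) :
    |normSecondDeriv X H H| ≤ 2 * (p - 1) * (‖H‖ ^ 2 / ‖X‖) := by
  have hp0 : 0 < p := by linarith
  have hpos : 0 < ‖X‖ := norm_pos_iff.2 hX
  obtain ⟨hq0, hq⟩ := traceDual_gradPowDeriv_bounds hp X H
  have ha := abs_normDeriv_le hp hX H
  set q := traceDual d p (gradPowDeriv X H) H
  set a := normDeriv X H with ha_def
  have hN1 : ‖X‖ ^ (1 - p) = ‖X‖ * ‖X‖ ^ (-p) := by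
    rw [sub_eq_add_neg, Real.rpow_add hpos, Real.rpow_one]
  have hN2 : ‖X‖ ^ (1 - p) * ‖X‖ ^ (p - 2) = ‖X‖⁻¹ := by
    rw [← Real.rpow_add hpos, show 1 - p + (p - 2) = -1 by ring, Real.rpow_neg_one]
  have heq : normSecondDeriv X H H
      = 1 / p * ‖X‖ ^ (1 - p) * q - (p - 1) * (a ^ 2 / ‖X‖) := by
    have h1 : normSecondDeriv X H H = 1 / p * ‖X‖ ^ (1 - p) * q
        + (1 - p) / p * ‖X‖ ^ (-p) * (a * traceDual d p (gradPow X) H) := rfl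
    have h2 : a = 1 / p * ‖X‖ ^ (1 - p) * traceDual d p (gradPow X) H := rfl
    have h3 : a / ‖X‖ = 1 / p * ‖X‖ ^ (-p) * traceDual d p (gradPow X) H := by
      rw [h2, hN1]
      field_simp
    rw [h1, sq, mul_div_assoc, h3]
    ring
  have hfirst : 1 / p * ‖X‖ ^ (1 - p) * q ≤ 2 * (p - 1) * (‖H‖ ^ 2 / ‖X‖) := by
    calc 1 / p * ‖X‖ ^ (1 - p) * q
        ≤ 1 / p * ‖X‖ ^ (1 - p) * (2 * (p * (p - 1)) * (‖X‖ ^ (p - 2) * ‖H‖ ^ 2)) :=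
          mul_le_mul_of_nonneg_left hq (by positivity)
      _ = 1 / p * (2 * (p * (p - 1))) * (‖X‖ ^ (1 - p) * ‖X‖ ^ (p - 2)) * ‖H‖ ^ 2 := by ring
      _ = 2 * (p - 1) * (‖H‖ ^ 2 / ‖X‖) := by
          rw [hN2]
          field_simp
  have hfirst0 : 0 ≤ 1 / p * ‖X‖ ^ (1 - p) * q := by positivity
  have ha2 : a ^ 2 / ‖X‖ ≤ ‖H‖ ^ 2 / ‖X‖ :=
    div_le_div_of_nonneg_right (sq_le_sq' (abs_le.1 ha).1 (abs_le.1 ha).2) hpos.le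
  have hsec : (p - 1) * (a ^ 2 / ‖X‖) ≤ (p - 1) * (‖H‖ ^ 2 / ‖X‖) :=
    mul_le_mul_of_nonneg_left ha2 (by linarith)
  have hsec0 : 0 ≤ (p - 1) * (a ^ 2 / ‖X‖) := mul_nonneg (by linarith) (by positivity)
  rw [heq, abs_le]
  constructor <;> linarith

end SchattenSym

theorem mainTheorem9 (d : ℕ) (p : ℝ) [Fact (1 ≤ p)] (hp : 2 ≤ p) :
    AssumptionA1 (SchattenSym d p) 1 (3 * (p - 1)) := by
  have hev : ∀ X : SchattenSym d p, X ≠ 0 → ∀ᶠ Y in nhds X,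
      HasGateauxDerivAt (fun Z : SchattenSym d p => ‖Z‖) (SchattenSym.normDeriv Y) Y := by
    intro X hX
    filter_upwards [isOpen_ne.mem_nhds hX] with Y hY
    exact SchattenSym.hasGateauxDerivAt_norm hp hY
  refine ⟨le_rfl, by linarith, fun X hX => ⟨SchattenSym.normDeriv, hev X hX,
    SchattenSym.normSecondDeriv X, SchattenSym.hasGateauxDerivAt_normDeriv hp hX⟩,
    fun X H hX => ?_, fun X H hX => ?_⟩
  · rw [gateauxDifferential, (SchattenSym.hasGateauxDerivAt_norm hp hX H).lineDeriv, one_mul]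
    exact SchattenSym.abs_normDeriv_le hp hX H
  · rw [secondGateauxDifferential_eq (hev X hX) (SchattenSym.hasGateauxDerivAt_normDeriv hp hX)]
    refine (SchattenSym.abs_normSecondDeriv_le hp hX H).trans
      (mul_le_mul_of_nonneg_right (by linarith) (by positivity))
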